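/- Let $n\ge 0$, let $\phi,\varphi:\mathbb R\to\mathbb R$ be continuously differentiable with $\phi'>0$ and $\varphi'<0$ everywhere, let $\lambda>0$, and let $\mathcal P_r$ be a Borel probability measure on $\mathbb R^n$ (Euclidean norm). For a Lipschitz $f:\mathbb R^n\to\mathbb R$ let $k(f)$ be its best Lipschitz constant. For a probability measure $\mathcal P_g$ call $f$ admissible if it is Lipschitz, $\phi\circ f$ is $\mathcal P_g$-integrable and $\varphi\circ f$ is $\mathcal P_r$-integrable, and put $$J(\mathcal P_g,f)=J_D+\lambda k(f)^2,\qquad J_D=\mathbb E_{x\sim\mathcal P_g}[\phi(f(x))]+\mathbb E_{x\sim\mathcal P_r}[\varphi(f(x))].$$ An optimal discriminator $f^*$ for $\mathcal P_g$ is an admissible minimizer of $J(\mathcal P_g,\cdot)$ over all admissible functions. Let $S_r,S_g$ denote the (closed) supports of $\mathcal P_r,\mathcal P_g$. If $\mathcal P_r,\mathcal P_g$ have Lebesgue densities $p_r,p_g$, let $U_r=\{p_r\ne0\}$, $U_g=\{p_g\neq 0\}$ and let $D(x)$ be the derivative at $t=f^*(x)$ of $t\mapsto p_g(x)\phi(t)+p_r(x)\varphi(t)$.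 Say that $y$ bounds $x$ if $y\ne x$ and $|f^*(y)-f^*(x)|=k(f^*)\|y-x\|$. Suppose that $\mathcal P_r$ and $\mathcal P_g$ have continuous densities and that $f^*$ is an optimal discriminator for $\mathcal P_g$. Then: (a) Every $x\in S_r\cup S_g$ with $D(x)\ne0$ is bounded by some $y\in U_r\cup U_g\subseteq S_r\cup S_g$. (b) Every $x\in (U_r\cup U_g)\setminus(U_r\cap U_g)$ is bounded by some $y\in U_r\cup U_g$. If $S_r\cup S_g$ is bounded, then also every $x\in(S_r\cup S_g)\setminus(S_r\cap S_g)$ is bounded by some $y\in S_r\cup S_g$. (c) Suppose that $\phi,\varphi$ are convex or that $S_r\cup S_g$ is bounded. If $S_r=S_g$ and $\mathcal P_r\ne\mathcal P_g$, then there are $x,y\in U_r\cup U_g$ such that $y$ bounds $x$ and $D(x)\neq0$. (d) Call $(\mathcal P_g,f)$, with $\mathcal P_g$ any Borel probability measure on $\mathbb R^n$, a Nash equilibrium if $f$ is an optimal discriminator for $\mathcal P_g$ and $J(\mathcal Q,f)\le J(\mathcal P_g,f)$ for every Borel probability measure $\mathcal Q$ for which $\phi\circ f$ is integrable (for this, $\mathcal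 P_r$ need not have a density). Every Nash equilibrium satisfies $\mathcal P_g=\mathcal P_r$ and $k(f)=0$. If $\phi,\varphi$ are convex and $\phi'(a)+\varphi'(a)=0$ for some $a$, then a Nash equilibrium with $\mathcal P_g=\mathcal P_r$ exists; if moreover $\phi$ or $\varphi$ is strictly convex, there is exactly one Nash equilibrium $(\mathcal P_g,f)$. Furthermore, in the setting of (a) and under the hypothesis of (c) that $\phi,\varphi$ are convex or $S_r\cup S_g$ is bounded, if $f^*$ is differentiable and $D(x)\nabla f^*(x)=0$ for all $x\in S_r\cup S_g$, then $\mathcal P_g=\mathcal P_r$ and $k(f^*)=0$. -/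

import Mathlib

open MeasureTheory
open scoped NNReal

noncomputable section

/-- Data space `ℝⁿ` with the Euclidean norm. -/
abbrev Pt (n : ℕ) : Type := EuclideanSpace ℝ (Fin n)

/-- The best Lipschitz constant `k(f)` (used only for Lipschitz `f`). -/
def lipConst {n : ℕ} (f : Pt n → ℝ) : ℝ≥0 := sInf {K : ℝ≥0 | LipschitzWith K f}

/-- `J_D = E_{x ∼ P_g} φ(f x) + E_{x ∼ P_r} ϕ(f x)`. -/
def discLoss {n : ℕ} (phi vphi : ℝ → ℝ) (Pr Pg : Measure (Pt n)) (f : Pt n → ℝ) : ℝ :=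
  (∫ x, phi (f x) ∂Pg) + ∫ x, vphi (f x) ∂Pr

/-- The penalized objective `J = J_D + lam * k(f)^2`. -/
def penObj {n : ℕ} (phi vphi : ℝ → ℝ) (lam : ℝ) (Pr Pg : Measure (Pt n)) (f : Pt n → ℝ) : ℝ :=
  discLoss phi vphi Pr Pg f + lam * (lipConst f : ℝ) ^ 2

/-- Discriminators at which the penalized objective is finite: `f` is Lipschitz and both
expectations exist. -/
def Admissible {n : ℕ} (phi vphi : ℝ → ℝ) (Pr Pg : Measure (Pt n)) (f : Pt n → ℝ) : Prop :=
  (∃ K : ℝ≥0, LipschitzWith K f) ∧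
    Integrable (fun x => phi (f x)) Pg ∧ Integrable (fun x => vphi (f x)) Pr

/-- `f` is an optimal discriminator: a global minimizer of the penalized objective. -/
def IsOptimalDisc {n : ℕ} (phi vphi : ℝ → ℝ) (lam : ℝ) (Pr Pg : Measure (Pt n))
    (f : Pt n → ℝ) : Prop :=
  Admissible phi vphi Pr Pg f ∧
    ∀ g : Pt n → ℝ, Admissible phi vphi Pr Pg g →
      penObj phi vphi lam Pr Pg f ≤ penObj phi vphi lam Pr Pg g

/-- `p` is a continuous density of `P` with respect to Lebesgue measure. -/
structure HasContDensity {n : ℕ} (P : Measure (Pt n)) (p : Pt n → ℝ) : Prop where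
  continuous : Continuous p
  nonneg : ∀ x, 0 ≤ p x
  eq_withDensity : P = (volume : Measure (Pt n)).withDensity (fun x => ENNReal.ofReal (p x))

/-- The pointwise objective at `x`, as a function of the value `t = f x`:
`p_g(x) φ(t) + p_r(x) ϕ(t)`. -/
def ptLoss {n : ℕ} (phi vphi : ℝ → ℝ) (pr pg : Pt n → ℝ) (x : Pt n) (t : ℝ) : ℝ :=
  pg x * phi t + pr x * vphi t

/-- The derivative of the pointwise objective at `x` with respect to the value `f x`. -/
def ptGrad {n : ℕ} (phi vphi : ℝ → ℝ) (pr pg : Pt n → ℝ) (f : Pt n → ℝ) (x : Pt n) : ℝ :=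
  deriv (ptLoss phi vphi pr pg x) (f x)

/-- `x` and `y` are distinct points in a bounding relationship. -/
def Bounds {n : ℕ} (f : Pt n → ℝ) (x y : Pt n) : Prop :=
  y ≠ x ∧ |f y - f x| = (lipConst f : ℝ) * ‖y - x‖

/-- Nash equilibrium of the zero-sum game with payoff `J`: the discriminator `f` minimizes and
the generator, whose strategies are the Borel probability measures on `ℝⁿ`, maximizes. -/
def IsNash {n : ℕ} (phi vphi : ℝ → ℝ) (lam : ℝ) (Pr Pg : Measure (Pt n)) (f : Pt n → ℝ) : Prop :=
  IsProbabilityMeasure Pg ∧ IsOptimalDisc phi vphi lam Pr Pg f ∧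
    ∀ Q : Measure (Pt n), IsProbabilityMeasure Q → Integrable (fun x => phi (f x)) Q →
      penObj phi vphi lam Pr Q f ≤ penObj phi vphi lam Pr Pg f

/-- First-order equilibrium: the discriminator is optimal and differentiable, and at every sample
the gradient `∂(pointwise objective)/∂f(x) · ∂f(x)/∂x` that moves the sample is zero. -/
def IsFirstOrderEquilibrium {n : ℕ} (phi vphi : ℝ → ℝ) (lam : ℝ) (Pr Pg : Measure (Pt n))
    (pr pg : Pt n → ℝ) (f : Pt n → ℝ) : Prop :=
  IsOptimalDisc phi vphi lam Pr Pg f ∧ Differentiable ℝ f ∧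
    ∀ x ∈ Pr.support ∪ Pg.support, ptGrad phi vphi pr pg f x • gradient f x = 0

end

/-! The penalty sees `f` only through k = k(f), so an optimal `f` admits no k-Lipschitz modification
on a compact set that lowers the pointwise loss p_g(x) phi(t) + p_r(x) vphi(t) somewhere and raises
it nowhere (`IsOptimalDisc.not_ptLoss_lt`). Let D(x) > 0, and cut `f` by the cone f(x) - δ + k‖y -
x‖. The result is still k-Lipschitz. If no point of a small sphere around x bounds x, compactness
gives a δ for which `f` changes only inside the sphere, where the loss increases in t: a
contradiction. The case D(x) < 0 follows by negating `f` and exchanging the distributions. For the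
closed supports D(x) may vanish, and a bounding point arises as a limit of bounding points for
nearby z.

If D vanishes everywhere, replacing `f` by (1 - ε)f changes the loss by o(ε), while a positive k
would make the penalty drop at first order; hence k = 0. A constant t is optimal only if phi'(t) E_g
u + vphi'(t) E_r u = 0 for all bounded Lipschitz u, and then the distributions agree.

In a Nash equilibrium, Dirac deviations of the generator show that P_g is carried by the maximum set
of `f`. Replacing `f` by its maximum keeps the first expectation and does not raise the second, so k
= 0 again. In a first-order equilibrium, a bounded point with zero gradient forces k = 0, because
`f` has slope k along the segment to the bounding point. -/

open Filter Topology

/-! ### The best Lipschitz constant. -/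

section LipschitzConstant

variable {n : ℕ} {f g : Pt n → ℝ} {K : ℝ≥0}

theorem lipConst_le (h : LipschitzWith K f) : lipConst f ≤ K :=
  csInf_le (OrderBot.bddBelow _) h

/-- Every difference quotient is a lower bound for all Lipschitz constants, hence at most their
infimum: the infimum is attained. -/
theorem lipschitzWith_lipConst (hf : ∃ K : ℝ≥0, LipschitzWith K f) :
    LipschitzWith (lipConst f) f := by
  refine LipschitzWith.of_dist_le_mul fun x y => ?_
  rcases eq_or_ne x y with rfl | hxy
  · simp
  have hd : 0 < dist x y := dist_pos.2 hxy
  rw [← div_le_iff₀ hd, ← Real.coe_toNNReal (dist (f x) (f y) / dist x y) (by positivity),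
    NNReal.coe_le_coe]
  refine le_csInf hf fun K hK => ?_
  rw [Real.toNNReal_le_iff_le_coe, div_le_iff₀ hd]
  exact hK.dist_le_mul x y

theorem lipConst_const (a : ℝ) : lipConst (fun _ : Pt n => a) = 0 :=
  le_antisymm (lipConst_le (LipschitzWith.const a)) bot_le

theorem eq_of_lipConst_eq_zero (hf : ∃ K : ℝ≥0, LipschitzWith K f) (h0 : lipConst f = 0)
    (x y : Pt n) : f x = f y := by
  have h := (lipschitzWith_lipConst hf).dist_le_mul x y
  rw [h0] at h
  exact dist_le_zero.1 (by simpa using h)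

theorem lipschitzWith_fun_neg_iff : LipschitzWith K (fun x => -f x) ↔ LipschitzWith K f := by
  simp only [LipschitzWith, edist_neg_neg]

theorem lipConst_neg : lipConst (fun x => -f x) = lipConst f := by
  simp only [lipConst, lipschitzWith_fun_neg_iff]

end LipschitzConstant

/-! ### Admissible competitors and the symmetry under negation. -/

section Admissibility

variable {n : ℕ} {phi vphi : ℝ → ℝ} {lam : ℝ} {Pr Pg : Measure (Pt n)} {f g : Pt n → ℝ}

theorem Admissible.continuous (h : Admissible phi vphi Pr Pg f) : Continuous f :=
  h.1.choose_spec.continuous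

theorem admissible_const [IsProbabilityMeasure Pr] [IsProbabilityMeasure Pg] (a : ℝ) :
    Admissible phi vphi Pr Pg (fun _ => a) :=
  ⟨⟨0, LipschitzWith.const a⟩, integrable_const _, integrable_const _⟩

theorem penObj_const [IsProbabilityMeasure Pr] [IsProbabilityMeasure Pg] (a : ℝ) :
    penObj phi vphi lam Pr Pg (fun _ => a) = phi a + vphi a := by
  simp [penObj, discLoss, lipConst_const]

/-- Negating the discriminator exchanges the roles of the two distributions. -/
theorem IsOptimalDisc.neg (h : IsOptimalDisc phi vphi lam Pr Pg f) :
    IsOptimalDisc (fun t => vphi (-t)) (fun t => phi (-t)) lam Pg Pr (fun x => -f x) := by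
  obtain ⟨⟨⟨K, hK⟩, h1, h2⟩, hmin⟩ := h
  refine ⟨⟨⟨K, lipschitzWith_fun_neg_iff.2 hK⟩, by simpa using h2, by simpa using h1⟩, ?_⟩
  rintro g ⟨⟨K', hK'⟩, h3, h4⟩
  have := hmin (fun x => -g x) ⟨⟨K', lipschitzWith_fun_neg_iff.2 hK'⟩, h4, h3⟩
  simp only [penObj, discLoss, lipConst_neg, neg_neg] at this ⊢
  linarith

/-- A monotone or antitone function of a convex combination of an integrand with a constant is
integrable as soon as the function of the integrand is. -/
theorem integrable_comp_of_mem_uIcc {P : Measure (Pt n)} [IsFiniteMeasure P] {u : ℝ → ℝ}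
    (hu : Continuous u) (hmono : Monotone u ∨ Antitone u) (hg : Continuous g)
    (hf : Integrable (fun x => u (f x)) P) (c : ℝ) (h : ∀ x, g x ∈ Set.uIcc (f x) c) :
    Integrable (fun x => u (g x)) P := by
  refine Integrable.mono' (hf.norm.add (integrable_const |u c|))
    (hu.comp hg).aestronglyMeasurable (ae_of_all _ fun x => ?_)
  have hx : u (g x) ∈ Set.uIcc (u (f x)) (u c) := by
    rcases hmono with hm | hm
    · exact hm.image_uIcc_subset (Set.mem_image_of_mem _ (h x))
    · exact hm.image_uIcc_subset (Set.mem_image_of_mem _ (h x))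
  rw [Set.mem_uIcc] at hx
  simp only [Real.norm_eq_abs, Pi.add_apply]
  rw [abs_le]
  have := neg_abs_le (u (f x))
  have := neg_abs_le (u c)
  have := le_abs_self (u (f x))
  have := le_abs_self (u c)
  rcases hx with ⟨h1, h2⟩ | ⟨h1, h2⟩ <;> constructor <;> linarith

/-- Changing an integrand on a compact set does not affect integrability. -/
theorem integrable_comp_of_eq_off_compact {P : Measure (Pt n)} [IsFiniteMeasure P] {u : ℝ → ℝ}
    (hu : Continuous u) (hfc : Continuous f) (hgc : Continuous g)
    (hf : Integrable (fun x => u (f x)) P) {C : Set (Pt n)} (hC : IsCompact C)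
    (h : ∀ᵐ x ∂P, x ∉ C → g x = f x) :
    Integrable (fun x => u (g x)) P := by
  have hc : Continuous fun x => u (g x) - u (f x) := (hu.comp hgc).sub (hu.comp hfc)
  obtain ⟨M, hM⟩ := hC.exists_bound_of_continuousOn hc.continuousOn
  have hint : Integrable (fun x => u (g x) - u (f x)) P := by
    refine Integrable.of_bound hc.aestronglyMeasurable (max M 0) ?_
    filter_upwards [h] with x hx
    by_cases hxC : x ∈ C
    · exact (hM x hxC).trans (le_max_left _ _)
    · simp [hx hxC]
  exact (hint.add hf).congr (ae_of_all _ fun x => by simp)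

end Admissibility

/-! ### Pointwise form of the objective for continuous densities. -/

section Density

variable {n : ℕ} {phi vphi : ℝ → ℝ} {lam : ℝ} {P Pr Pg : Measure (Pt n)} {p pr pg : Pt n → ℝ}
  {f g : Pt n → ℝ}

theorem HasContDensity.integrable_iff (hp : HasContDensity P p) (u : Pt n → ℝ) :
    Integrable u P ↔ Integrable (fun x => p x * u x) := by
  rw [hp.eq_withDensity, integrable_withDensity_iff_integrable_smul'
    hp.continuous.measurable.ennreal_ofReal (ae_of_all _ fun _ => ENNReal.ofReal_lt_top)]
  simp only [ENNReal.toReal_ofReal (hp.nonneg _), smul_eq_mul]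

theorem HasContDensity.integral_eq (hp : HasContDensity P p) (u : Pt n → ℝ) :
    ∫ x, u x ∂P = ∫ x, p x * u x := by
  rw [hp.eq_withDensity, integral_withDensity_eq_integral_toReal_smul
    hp.continuous.measurable.ennreal_ofReal (ae_of_all _ fun _ => ENNReal.ofReal_lt_top)]
  simp only [ENNReal.toReal_ofReal (hp.nonneg _), smul_eq_mul]

/-- The density is nonzero on an open set, and Lebesgue measure charges every nonempty open set. -/
theorem HasContDensity.measure_eq_zero_iff (hp : HasContDensity P p) {O : Set (Pt n)}
    (hO : IsOpen O) : P O = 0 ↔ ∀ y ∈ O, p y = 0 := by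
  rw [hp.eq_withDensity, withDensity_apply_eq_zero hp.continuous.measurable.ennreal_ofReal]
  have hset : {x | ENNReal.ofReal (p x) ≠ 0} = Function.support p := by
    ext x
    have := hp.nonneg x
    simp [Function.mem_support, this.lt_iff_ne, ne_comm]
  rw [hset, (hp.continuous.isOpen_support.inter hO).measure_eq_zero_iff volume,
    Set.eq_empty_iff_forall_notMem]
  simp only [Set.mem_inter_iff, Function.mem_support, not_and]
  exact forall_congr' fun x => by tauto

theorem HasContDensity.support_eq (hp : HasContDensity P p) :
    P.support = closure (Function.support p) := by
  ext x
  rw [← not_iff_not, Measure.notMem_support_iff_exists, mem_closure_iff_nhds]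
  push Not
  constructor
  · rintro ⟨U, hU, h0⟩
    refine ⟨interior U, interior_mem_nhds.2 hU, ?_⟩
    have := (hp.measure_eq_zero_iff isOpen_interior).1 (measure_mono_null interior_subset h0)
    ext y
    simpa using this y
  · rintro ⟨U, hU, h0⟩
    refine ⟨interior U, interior_mem_nhds.2 hU, (hp.measure_eq_zero_iff isOpen_interior).2 ?_⟩
    intro y hy
    by_contra hne
    exact (h0 ▸ ⟨interior_subset hy, hne⟩ : y ∈ (∅ : Set (Pt n)))

theorem HasContDensity.eq_zero_of_notMem_support (hp : HasContDensity P p) {x : Pt n}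
    (hx : x ∉ P.support) : p x = 0 := by
  by_contra h
  exact hx (hp.support_eq ▸ subset_closure h)

theorem HasContDensity.ae_density_ne_zero (hp : HasContDensity P p) : ∀ᵐ x ∂P, p x ≠ 0 := by
  rw [hp.eq_withDensity, ae_withDensity_iff hp.continuous.measurable.ennreal_ofReal]
  refine ae_of_all _ fun x hx h0 => hx (by simp [h0])

theorem Admissible.integrable_ptLoss (hr : HasContDensity Pr pr) (hg : HasContDensity Pg pg)
    (h : Admissible phi vphi Pr Pg f) : Integrable (fun x => ptLoss phi vphi pr pg x (f x)) :=
  ((hg.integrable_iff _).1 h.2.1).add ((hr.integrable_iff _).1 h.2.2)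

theorem Admissible.discLoss_eq (hr : HasContDensity Pr pr) (hg : HasContDensity Pg pg)
    (h : Admissible phi vphi Pr Pg f) :
    discLoss phi vphi Pr Pg f = ∫ x, ptLoss phi vphi pr pg x (f x) := by
  rw [discLoss, hg.integral_eq, hr.integral_eq,
    ← integral_add ((hg.integrable_iff _).1 h.2.1) ((hr.integrable_iff _).1 h.2.2)]
  rfl

theorem hasDerivAt_ptLoss (hphi : Differentiable ℝ phi) (hvphi : Differentiable ℝ vphi)
    (x : Pt n) (t : ℝ) :
    HasDerivAt (ptLoss phi vphi pr pg x) (pg x * deriv phi t + pr x * deriv vphi t) t :=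
  ((hphi t).hasDerivAt.const_mul _).add ((hvphi t).hasDerivAt.const_mul _)

theorem ptGrad_eq (hphi : Differentiable ℝ phi) (hvphi : Differentiable ℝ vphi) (x : Pt n) :
    ptGrad phi vphi pr pg f x = pg x * deriv phi (f x) + pr x * deriv vphi (f x) :=
  (hasDerivAt_ptLoss hphi hvphi x _).deriv

theorem mem_support_of_ptGrad_ne_zero (hphi : Differentiable ℝ phi)
    (hvphi : Differentiable ℝ vphi) {x : Pt n} (h : ptGrad phi vphi pr pg f x ≠ 0) :
    x ∈ Function.support pr ∪ Function.support pg := by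
  rw [ptGrad_eq hphi hvphi] at h
  by_contra hx
  simp only [Set.mem_union, Function.mem_support, not_or, not_not] at hx
  simp [hx.1, hx.2] at h

theorem ptGrad_neg (hphi : Differentiable ℝ phi) (hvphi : Differentiable ℝ vphi) (x : Pt n) :
    ptGrad (fun t => vphi (-t)) (fun t => phi (-t)) pg pr (fun x => -f x) x =
      -ptGrad phi vphi pr pg f x := by
  rw [ptGrad_eq hphi hvphi, ptGrad_eq (by fun_prop) (by fun_prop), deriv_comp_neg, deriv_comp_neg]
  simp only [neg_neg]
  ring

/-- An optimal discriminator cannot be improved pointwise on a compact set without increasing its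
Lipschitz constant. -/
theorem IsOptimalDisc.not_ptLoss_lt [IsProbabilityMeasure Pr] [IsProbabilityMeasure Pg]
    (hphi : Continuous phi) (hvphi : Continuous vphi) (hlam : 0 < lam)
    (hr : HasContDensity Pr pr) (hg : HasContDensity Pg pg)
    (hf : IsOptimalDisc phi vphi lam Pr Pg f) (hlip : LipschitzWith (lipConst f) g)
    {C : Set (Pt n)} (hC : IsCompact C)
    (heq : ∀ y ∈ Function.support pr ∪ Function.support pg, y ∉ C → g y = f y)
    (hle : ∀ y, ptLoss phi vphi pr pg y (g y) ≤ ptLoss phi vphi pr pg y (f y)) (x : Pt n) :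
    ¬ ptLoss phi vphi pr pg x (g x) < ptLoss phi vphi pr pg x (f x) := by
  intro hlt
  have hfc := hf.1.continuous
  have hgc := hlip.continuous
  have hadm : Admissible phi vphi Pr Pg g := by
    refine ⟨⟨_, hlip⟩, ?_, ?_⟩
    · refine integrable_comp_of_eq_off_compact hphi hfc hgc hf.1.2.1 hC ?_
      filter_upwards [hg.ae_density_ne_zero] with y hy using heq y (Or.inr hy)
    · refine integrable_comp_of_eq_off_compact hvphi hfc hgc hf.1.2.2 hC ?_
      filter_upwards [hr.ae_density_ne_zero] with y hy using heq y (Or.inl hy)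
  have hmin := hf.2 g hadm
  have hk : (lipConst g : ℝ) ^ 2 ≤ (lipConst f : ℝ) ^ 2 := by
    have := lipConst_le hlip
    gcongr
  have h1 := mul_le_mul_of_nonneg_left hk hlam.le
  simp only [penObj] at hmin
  rw [hf.1.discLoss_eq hr hg, hadm.discLoss_eq hr hg] at hmin
  have hif := hf.1.integrable_ptLoss hr hg
  have hig := hadm.integrable_ptLoss hr hg
  have hpc := hr.continuous
  have hqc := hg.continuous
  have hcont : Continuous fun y =>
      ptLoss phi vphi pr pg y (f y) - ptLoss phi vphi pr pg y (g y) := by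
    unfold ptLoss
    fun_prop
  -- By continuity the strict gain at x persists on an open set, which has positive volume.
  have hpos : 0 < ∫ y, (ptLoss phi vphi pr pg y (f y) - ptLoss phi vphi pr pg y (g y)) := by
    rw [integral_pos_iff_support_of_nonneg (fun y => sub_nonneg.2 (hle y)) (hif.sub hig)]
    exact hcont.isOpen_support.measure_pos _ ⟨x, (sub_pos.2 hlt).ne'⟩
  rw [integral_sub hif hig] at hpos
  linarith

end Density

/-! ### Existence of bounding points by cutting with cones. -/

section Bounding

variable {n : ℕ} {phi vphi : ℝ → ℝ} {lam : ℝ} {Pr Pg : Measure (Pt n)} {pr pg : Pt n → ℝ}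
  {f : Pt n → ℝ}

theorem bounds_neg_iff {x y : Pt n} : Bounds (fun x => -f x) x y ↔ Bounds f x y := by
  rw [Bounds, Bounds, lipConst_neg, neg_sub_neg, abs_sub_comm]

/-- Cutting a `K`-Lipschitz function by a cone of slope `K` leaves it `K`-Lipschitz. -/
theorem lipschitzWith_min_cone {K : ℝ≥0} (hf : LipschitzWith K f) (x : Pt n) (a : ℝ) :
    LipschitzWith K fun y => min (f y) (a + K * dist y x) := by
  have hcone : LipschitzWith K fun y => a + K * dist y x := by
    refine LipschitzWith.of_dist_le_mul fun y z => ?_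
    rw [Real.dist_eq, add_sub_add_left_eq_sub, ← mul_sub, abs_mul, abs_of_nonneg K.coe_nonneg]
    gcongr
    exact abs_dist_sub_le y z x
  simpa using hf.min hcone

/-- A gap in the Lipschitz estimate on a sphere propagates to the exterior of the sphere. -/
theorem sub_le_of_forall_mem_sphere {K : ℝ≥0} (hf : LipschitzWith K f) {x : Pt n} {r δ : ℝ}
    (hr : 0 < r) (h : ∀ z ∈ Metric.sphere x r, f z - f x ≤ K * r - δ) {y : Pt n}
    (hy : r ≤ dist y x) : f y - f x ≤ K * dist y x - δ := by
  have hd : 0 < dist y x := hr.trans_le hy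
  -- The segment from x to y crosses the sphere at parameter r / dist y x; the gap found there is
  -- kept along the rest of the segment.
  have hz1 : dist (AffineMap.lineMap x y (r / dist y x) : Pt n) x = r := by
    rw [dist_lineMap_left, Real.norm_of_nonneg (by positivity), dist_comm x y]
    field_simp
  have hz2 : dist y (AffineMap.lineMap x y (r / dist y x) : Pt n) = dist y x - r := by
    have h1 : r / dist y x ≤ 1 := (div_le_one hd).2 hy
    rw [dist_comm, dist_lineMap_right, Real.norm_of_nonneg (by linarith), dist_comm x y]
    field_simp
  have h1 := h _ hz1
  have h2 := (le_abs_self _).trans (hf.dist_le_mul y (AffineMap.lineMap x y (r / dist y x)))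
  rw [hz2] at h2
  linarith

/-- On a compact set, a strict inequality holds with a uniform gap. -/
theorem exists_pos_forall_add_le {C : Set (Pt n)} (hC : IsCompact C) {u v : Pt n → ℝ}
    (hu : Continuous u) (hv : Continuous v) (h : ∀ y ∈ C, u y < v y) :
    ∃ δ > 0, ∀ y ∈ C, u y + δ ≤ v y := by
  rcases C.eq_empty_or_nonempty with rfl | hne
  · exact ⟨1, one_pos, by simp⟩
  obtain ⟨z, hz, hmin⟩ := hC.exists_isMinOn hne (hv.sub hu).continuousOn
  refine ⟨v z - u z, sub_pos.2 (h z hz), fun y hy => ?_⟩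
  have : v z - u z ≤ v y - u y := hmin hy
  linarith

theorem IsOptimalDisc.exists_bounds_of_ptGrad_pos [IsProbabilityMeasure Pr]
    [IsProbabilityMeasure Pg] (hphi : ContDiff ℝ 1 phi) (hvphi : ContDiff ℝ 1 vphi)
    (hlam : 0 < lam) (hr : HasContDensity Pr pr) (hg : HasContDensity Pg pg)
    (hf : IsOptimalDisc phi vphi lam Pr Pg f) {x : Pt n} (hx : 0 < ptGrad phi vphi pr pg f x) :
    ∃ y ∈ Function.support pr ∪ Function.support pg, Bounds f x y := by
  have hdphi : Differentiable ℝ phi := hphi.differentiable one_ne_zero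
  have hdvphi : Differentiable ℝ vphi := hvphi.differentiable one_ne_zero
  have hlip := lipschitzWith_lipConst hf.1.1
  set k := lipConst f with hk
  have hcont : Continuous fun q : Pt n × ℝ =>
      pg q.1 * deriv phi q.2 + pr q.1 * deriv vphi q.2 :=
    ((hg.continuous.comp continuous_fst).mul
      ((hphi.continuous_deriv le_rfl).comp continuous_snd)).add
      ((hr.continuous.comp continuous_fst).mul
        ((hvphi.continuous_deriv le_rfl).comp continuous_snd))
  rw [ptGrad_eq hdphi hdvphi] at hx
  obtain ⟨ε, hε, hball⟩ := Metric.isOpen_iff.1 (hcont.isOpen_preimage _ isOpen_Ioi)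
    (x, f x) (show (0 : ℝ) < _ from hx)
  have hpos : ∀ y t, dist y x < ε → |t - f x| < ε →
      0 < pg y * deriv phi t + pr y * deriv vphi t := fun y t hy ht =>
    hball (show (y, t) ∈ Metric.ball (x, f x) ε from by
      rw [Metric.mem_ball, Prod.dist_eq]; exact max_lt hy ht)
  have hk0 : (0 : ℝ) ≤ k := k.coe_nonneg
  -- With k r ≤ ε / 4 and later δ ≤ ε / 4, all values between the cut function and `f` on the ball
  -- stay within ε of f(x), where the derivative is positive.
  obtain ⟨r, hr0, hrε, hkr⟩ : ∃ r > 0, r < ε ∧ k * r ≤ ε / 4 := by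
    refine ⟨min (ε / 2) (ε / (4 * (k + 1))), by positivity,
      (min_le_left _ _).trans_lt (by linarith), ?_⟩
    calc (k : ℝ) * min (ε / 2) (ε / (4 * (k + 1))) ≤ (k + 1) * (ε / (4 * (k + 1))) := by
          gcongr
          · linarith
          · exact min_le_right _ _
      _ = ε / 4 := by field_simp
  -- A positive derivative excludes that both densities vanish, so the sphere of radius r lies in
  -- the required set.
  have hsupp : ∀ y, dist y x < ε → y ∈ Function.support pr ∪ Function.support pg := by
    intro y hy
    have := hpos y (f x) hy (by simpa using hε)
    by_contra hcon
    simp only [Set.mem_union, Function.mem_support, not_or, not_not] at hcon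
    simp [hcon.1, hcon.2] at this
  by_contra! hno
  have hstrict : ∀ y ∈ Metric.sphere x r, f y < f x + k * r := by
    intro y hy
    have hd : dist y x = r := hy
    have hne : |f y - f x| ≠ k * r := fun h => hno y (hsupp y (hd ▸ hrε))
      ⟨dist_pos.1 (hd ▸ hr0), by rw [h, ← dist_eq_norm, hd]⟩
    have hle := hlip.dist_le_mul y x
    rw [hd, Real.dist_eq] at hle
    linarith [le_abs_self (f y - f x), lt_of_le_of_ne hle hne]
  obtain ⟨δ₀, hδ₀, hgap⟩ := exists_pos_forall_add_le (isCompact_sphere x r) hf.1.continuous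
    continuous_const hstrict
  set δ := min δ₀ (ε / 4) with hδ
  have hδ0 : 0 < δ := by positivity
  have hδ1 : δ ≤ ε / 4 := min_le_right _ _
  have hext : ∀ y, r ≤ dist y x → f y - f x ≤ k * dist y x - δ := fun y hy =>
    sub_le_of_forall_mem_sphere hlip hr0 (fun z hz => by
      linarith [hgap z hz, min_le_left δ₀ (ε / 4)]) hy
  set g : Pt n → ℝ := fun y => min (f y) (f x - δ + k * dist y x) with hgdef
  have hgeq : ∀ y, r ≤ dist y x → g y = f y := fun y hy => min_eq_left (by linarith [hext y hy])
  have hgx : g x = f x - δ := by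
    simp only [hgdef, dist_self, mul_zero, add_zero]
    exact min_eq_right (by linarith)
  have hmono : ∀ y, dist y x ≤ r →
      StrictMonoOn (ptLoss phi vphi pr pg y) (Set.Icc (f y - δ) (f y)) := by
    intro y hy
    have hfy := hlip.dist_le_mul y x
    rw [Real.dist_eq, abs_le] at hfy
    have hky : (k : ℝ) * dist y x ≤ k * r := by gcongr
    refine strictMonoOn_of_deriv_pos (convex_Icc _ _)
      (fun t _ => (hasDerivAt_ptLoss hdphi hdvphi y t).continuousAt.continuousWithinAt) ?_
    intro t ht
    rw [interior_Icc] at ht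
    rw [(hasDerivAt_ptLoss hdphi hdvphi y t).deriv]
    refine hpos y t (hy.trans_lt hrε) (abs_lt.2 ⟨?_, ?_⟩) <;> linarith [ht.1, ht.2, hfy.1, hfy.2]
  have hgIcc : ∀ y, g y ∈ Set.Icc (f y - δ) (f y) := by
    intro y
    refine ⟨le_min (by linarith) ?_, min_le_left _ _⟩
    have hfy := hlip.dist_le_mul y x
    rw [Real.dist_eq, abs_le] at hfy
    linarith [hfy.2]
  have hright : ∀ y, f y ∈ Set.Icc (f y - δ) (f y) := fun y => ⟨by linarith, le_rfl⟩
  refine hf.not_ptLoss_lt hphi.continuous hvphi.continuous hlam hr hg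
    (lipschitzWith_min_cone hlip x (f x - δ)) (isCompact_closedBall x r) ?_ ?_ x ?_
  · intro y _ hy
    exact hgeq y (not_le.1 (by simpa using hy)).le
  · intro y
    rcases le_total (dist y x) r with hy | hy
    · exact (hmono y hy).monotoneOn (hgIcc y) (hright y) (hgIcc y).2
    · exact (congrArg _ (hgeq y hy)).le
  · exact hmono x (by simpa using hr0.le) (hgIcc x) (hright x)
      (show g x < f x by linarith [hgx])

/-- Negating `f` and exchanging the distributions flips the sign of the derivative, which reduces
the negative case to the positive one. -/
theorem IsOptimalDisc.exists_bounds_of_ptGrad_ne_zero [IsProbabilityMeasure Pr]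
    [IsProbabilityMeasure Pg] (hphi : ContDiff ℝ 1 phi) (hvphi : ContDiff ℝ 1 vphi)
    (hlam : 0 < lam) (hr : HasContDensity Pr pr) (hg : HasContDensity Pg pg)
    (hf : IsOptimalDisc phi vphi lam Pr Pg f) {x : Pt n} (hx : ptGrad phi vphi pr pg f x ≠ 0) :
    ∃ y ∈ Function.support pr ∪ Function.support pg, Bounds f x y := by
  rcases hx.lt_or_gt with hneg | hpos
  · have hgrad := ptGrad_neg (pr := pr) (pg := pg) (f := f) (hphi.differentiable one_ne_zero)
      (hvphi.differentiable one_ne_zero) x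
    obtain ⟨y, hy, hb⟩ := hf.neg.exists_bounds_of_ptGrad_pos (hvphi.comp contDiff_neg)
      (hphi.comp contDiff_neg) hlam hg hr (x := x)
      (lt_of_lt_of_eq (neg_pos.2 hneg) hgrad.symm)
    exact ⟨y, Or.symm hy, bounds_neg_iff.1 hb⟩
  · exact hf.exists_bounds_of_ptGrad_pos hphi hvphi hlam hr hg hpos

/-- Here p_g(x) = 0 is possible, so the derivative may vanish at x. On a ball free of p_r, however,
the loss p_g phi(t) is nondecreasing in t over all of ℝ, so the cut may alter `f` by any amount
there. -/
theorem IsOptimalDisc.exists_bounds_of_mem_support_gen [IsProbabilityMeasure Pr]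
    [IsProbabilityMeasure Pg] (hphi : Continuous phi) (hvphi : Continuous vphi)
    (hmono : StrictMono phi) (hlam : 0 < lam) (hr : HasContDensity Pr pr)
    (hg : HasContDensity Pg pg) (hf : IsOptimalDisc phi vphi lam Pr Pg f)
    (hbdd : Bornology.IsBounded (Pr.support ∪ Pg.support)) {x : Pt n}
    (hxg : x ∈ Pg.support) (hxr : x ∉ Pr.support) :
    ∃ y ∈ Pr.support ∪ Pg.support, Bounds f x y := by
  have hlip := lipschitzWith_lipConst hf.1.1
  have hfc := hf.1.continuous
  set k := lipConst f with hk
  set S := Pr.support ∪ Pg.support with hS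
  have hScomp : IsCompact S := Metric.isCompact_of_isClosed_isBounded
    (Measure.isClosed_support.union Measure.isClosed_support) hbdd
  have hzero : ∀ y ∉ S, pr y = 0 ∧ pg y = 0 := fun y hy =>
    ⟨hr.eq_zero_of_notMem_support fun h => hy (Or.inl h),
      hg.eq_zero_of_notMem_support fun h => hy (Or.inr h)⟩
  obtain ⟨ρ, hρ, hball⟩ := Metric.isOpen_iff.1 Measure.isOpen_compl_support x hxr
  have hpr : ∀ y ∈ Metric.ball x ρ, pr y = 0 := fun y hy =>
    hr.eq_zero_of_notMem_support (hball hy)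
  have hCcomp : IsCompact (S \ Metric.ball x ρ) := hScomp.diff Metric.isOpen_ball
  -- Only the values on the compact set `S \ ball` must be preserved by the cut, so the bounding
  -- point of z can be found outside the ball.
  have hkey : ∀ z ∈ Metric.ball x ρ, pg z ≠ 0 →
      ∃ y ∈ S \ Metric.ball x ρ, f y = f z + k * dist y z := by
    intro z hz hpz
    by_contra! hno
    have hstrict : ∀ y ∈ S \ Metric.ball x ρ, f y < f z + k * dist y z := by
      intro y hy
      have hle := (le_abs_self _).trans (hlip.dist_le_mul y z)
      exact lt_of_le_of_ne (by linarith) (hno y hy)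
    obtain ⟨δ, hδ, hgap⟩ := exists_pos_forall_add_le hCcomp hfc
      (by fun_prop : Continuous fun y => f z + k * dist y z) hstrict
    set g : Pt n → ℝ := fun y => min (f y) (f z - δ + k * dist y z) with hgdef
    have hpgz : 0 < pg z := lt_of_le_of_ne (hg.nonneg z) hpz.symm
    refine hf.not_ptLoss_lt hphi hvphi hlam hr hg
      (lipschitzWith_min_cone hlip z (f z - δ)) hScomp ?_ ?_ z ?_
    · intro y hy hyS
      have := hzero y hyS
      rcases hy with hy | hy
      · exact absurd this.1 hy
      · exact absurd this.2 hy
    · intro y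
      by_cases hyS : y ∈ S
      · by_cases hyb : y ∈ Metric.ball x ρ
        · simp only [ptLoss, hpr y hyb, zero_mul, add_zero]
          exact mul_le_mul_of_nonneg_left (hmono.monotone (min_le_left _ _)) (hg.nonneg y)
        · have := hgap y ⟨hyS, hyb⟩
          rw [min_eq_left (by linarith)]
      · simp [ptLoss, hzero y hyS]
    · simp only [ptLoss, hpr z hz, zero_mul, add_zero, dist_self, mul_zero]
      exact mul_lt_mul_of_pos_left (hmono ((min_le_right _ _).trans_lt (by linarith))) hpgz
  have hxcl : x ∈ closure (Metric.ball x ρ ∩ Function.support pg) :=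
    Metric.isOpen_ball.inter_closure ⟨Metric.mem_ball_self hρ, hg.support_eq ▸ hxg⟩
  obtain ⟨z, hz, hzlim⟩ := mem_closure_iff_seq_limit.1 hxcl
  choose y hyC hy using fun i => hkey (z i) (hz i).1 (hz i).2
  obtain ⟨w, hwC, s, hs, hwlim⟩ := hCcomp.tendsto_subseq hyC
  have hzs := hzlim.comp hs.tendsto_atTop
  have hlim1 : Tendsto (fun i => f (y (s i))) atTop (𝓝 (f w)) := (hfc.tendsto w).comp hwlim
  have hlim2 : Tendsto (fun i => f (z (s i)) + k * dist (y (s i)) (z (s i))) atTop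
      (𝓝 (f x + k * dist w x)) :=
    ((hfc.tendsto x).comp hzs).add ((hwlim.dist hzs).const_mul _)
  have heq : f w = f x + k * dist w x :=
    tendsto_nhds_unique hlim1 (hlim2.congr fun i => (hy (s i)).symm)
  -- The bounding points avoid a fixed ball around x, so their limit differs from x.
  refine ⟨w, hwC.1, ?_, ?_⟩
  · rintro rfl
    exact hwC.2 (Metric.mem_ball_self hρ)
  · rw [heq, add_sub_cancel_left, dist_eq_norm, abs_of_nonneg (by positivity)]

end Bounding

/-! ### Constant optimal discriminators and vanishing pointwise gradients. -/

section ConstantDiscriminator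

variable {n : ℕ} {phi vphi : ℝ → ℝ} {lam : ℝ} {P Pr Pg : Measure (Pt n)} {pr pg : Pt n → ℝ}
  {f : Pt n → ℝ}

/-- First variation at a constant. As h is bounded, only values of `deriv u` on a compact interval
enter, and they give a constant dominating bound. -/
theorem hasDerivAt_integral_comp_add_mul [IsProbabilityMeasure P] {u : ℝ → ℝ}
    (hu : ContDiff ℝ 1 u) {h : Pt n → ℝ} (hh : Continuous h) {M : ℝ} (hM : ∀ x, |h x| ≤ M)
    (t : ℝ) :
    HasDerivAt (fun ε : ℝ => ∫ x, u (t + ε * h x) ∂P) (deriv u t * ∫ x, h x ∂P) 0 := by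
  have hdu : Differentiable ℝ u := hu.differentiable one_ne_zero
  have hcu : Continuous (deriv u) := hu.continuous_deriv le_rfl
  have hcc := hu.continuous
  obtain ⟨N, hN⟩ := (isCompact_closedBall t M).exists_bound_of_continuousOn hcu.continuousOn
  have hM0 : 0 ≤ M := (abs_nonneg _).trans (hM 0)
  have hbound : ∀ ε ∈ Metric.ball (0 : ℝ) 1, ∀ x, ‖deriv u (t + ε * h x) * h x‖ ≤ N * M := by
    intro ε hε x
    have hε' : |ε| ≤ 1 := by simpa using (Metric.mem_ball.1 hε).le
    have hmem : t + ε * h x ∈ Metric.closedBall t M := by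
      rw [Metric.mem_closedBall, Real.dist_eq, add_sub_cancel_left, abs_mul]
      calc |ε| * |h x| ≤ 1 * M := by gcongr; exact hM x
        _ = M := one_mul M
    have h1 := hN _ hmem
    rw [norm_mul]
    gcongr
    · exact (norm_nonneg _).trans h1
    · exact hM x
  have key := hasDerivAt_integral_of_dominated_loc_of_deriv_le (μ := P)
    (F := fun ε x => u (t + ε * h x)) (F' := fun ε x => deriv u (t + ε * h x) * h x)
    (bound := fun _ => N * M) (x₀ := (0 : ℝ)) (Metric.ball_mem_nhds 0 one_pos)
    (Eventually.of_forall fun ε => (by fun_prop : Continuous _).aestronglyMeasurable)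
    (by simp) (by fun_prop : Continuous _).aestronglyMeasurable
    (ae_of_all _ fun x ε hε => hbound ε hε x) (integrable_const _)
    (ae_of_all _ fun x ε _ => ?_)
  · have hkey := key.2
    simp only [zero_mul, add_zero, integral_const_mul] at hkey
    exact hkey
  · have hin : HasDerivAt (fun ε : ℝ => t + ε * h x) (h x) ε := by
      simpa using ((hasDerivAt_id ε).mul_const (h x)).const_add t
    exact (hdu _).hasDerivAt.comp ε hin

theorem measure_eq_of_forall_lipschitz_integral_eq [IsProbabilityMeasure Pr]
    [IsProbabilityMeasure Pg]
    (h : ∀ u : Pt n → ℝ, (∃ M : ℝ, ∀ x, |u x| ≤ M) → (∃ L : ℝ≥0, LipschitzWith L u) →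
      ∫ x, u x ∂Pg = ∫ x, u x ∂Pr) : Pg = Pr := by
  let μ : ProbabilityMeasure (Pt n) := ⟨Pg, inferInstance⟩
  let ν : ProbabilityMeasure (Pt n) := ⟨Pr, inferInstance⟩
  -- Bounded Lipschitz functions test weak convergence, so the constant sequence μ converges to ν;
  -- limits are unique.
  have hlim : Tendsto (fun _ : ℕ => μ) atTop (𝓝 ν) := by
    rw [tendsto_iff_forall_lipschitz_integral_tendsto]
    rintro u ⟨C, hC⟩ hL
    have hu : ∀ x, |u x| ≤ C + |u 0| := fun x => by
      have h1 := hC x 0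
      rw [Real.dist_eq] at h1
      linarith [abs_sub_abs_le_abs_sub (u x) (u 0)]
    have := h u ⟨_, hu⟩ hL
    change Tendsto (fun _ : ℕ => ∫ x, u x ∂Pg) atTop (𝓝 (∫ x, u x ∂Pr))
    rw [this]
    exact tendsto_const_nhds
  have : μ = ν := tendsto_nhds_unique tendsto_const_nhds hlim
  exact congrArg Subtype.val this

/-- A constant can be an optimal discriminator only if the two distributions agree. -/
theorem IsOptimalDisc.measure_eq_of_const [IsProbabilityMeasure Pr] [IsProbabilityMeasure Pg]
    (hphi : ContDiff ℝ 1 phi) (hvphi : ContDiff ℝ 1 vphi) (hphi' : ∀ t, 0 < deriv phi t)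
    (hlam : 0 < lam) {t : ℝ} (hf : IsOptimalDisc phi vphi lam Pr Pg fun _ => t) : Pg = Pr := by
  have hcphi := hphi.continuous
  have hcvphi := hvphi.continuous
  have key : ∀ u : Pt n → ℝ, (∃ M : ℝ, ∀ x, |u x| ≤ M) → (∃ L : ℝ≥0, LipschitzWith L u) →
      deriv phi t * ∫ x, u x ∂Pg + deriv vphi t * ∫ x, u x ∂Pr = 0 := by
    rintro u ⟨M, hM⟩ ⟨L, hL⟩
    have huc := hL.continuous
    have hsq : HasDerivAt (fun ε : ℝ => lam * (ε ^ 2 * (L : ℝ) ^ 2)) 0 0 := by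
      simpa using (((hasDerivAt_id (0 : ℝ)).pow 2).mul_const ((L : ℝ) ^ 2)).const_mul lam
    have hder := ((hasDerivAt_integral_comp_add_mul (P := Pg) hphi huc hM t).add
      (hasDerivAt_integral_comp_add_mul (P := Pr) hvphi huc hM t)).add hsq
    -- The penalty of t + ε u is replaced by its upper bound lam ε² L², which is exact at ε = 0 and
    -- has derivative 0 there.
    have hmin : IsLocalMin (((fun ε : ℝ => ∫ x, phi (t + ε * u x) ∂Pg) +
        fun ε : ℝ => ∫ x, vphi (t + ε * u x) ∂Pr) +
        fun ε : ℝ => lam * (ε ^ 2 * (L : ℝ) ^ 2)) 0 := by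
      refine Eventually.of_forall fun ε => ?_
      have hlip : LipschitzWith (‖ε‖₊ * L) fun x => t + ε * u x := by
        refine LipschitzWith.of_dist_le_mul fun x y => ?_
        have := hL.dist_le_mul x y
        rw [Real.dist_eq] at this ⊢
        rw [add_sub_add_left_eq_sub, ← mul_sub, abs_mul, NNReal.coe_mul, coe_nnnorm,
          Real.norm_eq_abs, mul_assoc]
        gcongr
      have hmem : ∀ x, t + ε * u x ∈ Metric.closedBall t (|ε| * M) := fun x => by
        rw [Metric.mem_closedBall, Real.dist_eq, add_sub_cancel_left, abs_mul]
        gcongr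
        exact hM x
      have hint : ∀ (v : ℝ → ℝ), Continuous v → ∀ (P : Measure (Pt n)) [IsProbabilityMeasure P],
          Integrable (fun x => v (t + ε * u x)) P := by
        intro v hv P _
        obtain ⟨N, hN⟩ := (isCompact_closedBall t (|ε| * M)).exists_bound_of_continuousOn
          hv.continuousOn
        exact Integrable.of_bound (by fun_prop : Continuous _).aestronglyMeasurable N
          (ae_of_all _ fun x => hN _ (hmem x))
      have h1 := hf.2 _ ⟨⟨_, hlip⟩, hint phi hcphi Pg, hint vphi hcvphi Pr⟩
      rw [penObj_const] at h1
      have h2 : (lipConst fun x => t + ε * u x : ℝ) ^ 2 ≤ ε ^ 2 * (L : ℝ) ^ 2 := by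
        have h3 : (lipConst fun x => t + ε * u x : ℝ) ≤ |ε| * L := by
          simpa using NNReal.coe_le_coe.2 (lipConst_le hlip)
        calc _ ≤ (|ε| * (L : ℝ)) ^ 2 := by gcongr
          _ = ε ^ 2 * (L : ℝ) ^ 2 := by rw [mul_pow, sq_abs]
      have h4 := mul_le_mul_of_nonneg_left h2 hlam.le
      simp only [penObj, discLoss] at h1
      simp only [Pi.add_apply, zero_mul, add_zero, integral_const, probReal_univ, one_smul, ne_eq,
        OfNat.ofNat_ne_zero, not_false_eq_true, zero_pow, mul_zero]
      linarith
    simpa using hmin.hasDerivAt_eq_zero hder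
  -- The test function 1 makes the two derivatives opposite, so the identity for general u compares
  -- the two expectations.
  have h1 : deriv phi t + deriv vphi t = 0 := by
    simpa using key (fun _ => 1) ⟨1, by simp⟩ ⟨0, LipschitzWith.const 1⟩
  refine measure_eq_of_forall_lipschitz_integral_eq fun u hM hL => ?_
  have h2 := key u hM hL
  have h3 : deriv vphi t = -deriv phi t := by linarith
  rw [h3, neg_mul, ← sub_eq_add_neg, ← mul_sub] at h2
  exact sub_eq_zero.1 ((mul_eq_zero.1 h2).resolve_left (hphi' t).ne')

theorem IsOptimalDisc.measure_eq_of_lipConst_eq_zero [IsProbabilityMeasure Pr]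
    [IsProbabilityMeasure Pg] (hphi : ContDiff ℝ 1 phi) (hvphi : ContDiff ℝ 1 vphi)
    (hphi' : ∀ t, 0 < deriv phi t) (hlam : 0 < lam) (hf : IsOptimalDisc phi vphi lam Pr Pg f)
    (h0 : lipConst f = 0) : Pg = Pr := by
  have hconst : f = fun _ => f 0 := funext fun x => eq_of_lipConst_eq_zero hf.1.1 h0 x 0
  rw [hconst] at hf
  exact hf.measure_eq_of_const hphi hvphi hphi' hlam

/-- The change of the pointwise objective when a discriminator with everywhere critical values is
shrunk towards zero is dominated by an integrable function. -/
theorem IsOptimalDisc.exists_integrable_bound_of_ptGrad_eq_zero [IsProbabilityMeasure Pr]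
    [IsProbabilityMeasure Pg] (hphi : ContDiff ℝ 1 phi) (hvphi : ContDiff ℝ 1 vphi)
    (hr : HasContDensity Pr pr) (hg : HasContDensity Pg pg)
    (hf : IsOptimalDisc phi vphi lam Pr Pg f)
    (hcase : (ConvexOn ℝ Set.univ phi ∧ ConvexOn ℝ Set.univ vphi) ∨
      Bornology.IsBounded (Pr.support ∪ Pg.support))
    (hgrad : ∀ x, ptGrad phi vphi pr pg f x = 0) :
    ∃ G : Pt n → ℝ, Integrable G ∧ ∀ x, ∀ ε ∈ Set.Ioc (0 : ℝ) 1,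
      |ptLoss phi vphi pr pg x ((1 - ε) * f x) - ptLoss phi vphi pr pg x (f x)| ≤ ε * G x := by
  have hdphi : Differentiable ℝ phi := hphi.differentiable one_ne_zero
  have hdvphi : Differentiable ℝ vphi := hvphi.differentiable one_ne_zero
  rcases hcase with ⟨hc1, hc2⟩ | hbdd
  · refine ⟨fun x => ptLoss phi vphi pr pg x 0 - ptLoss phi vphi pr pg x (f x),
      ((admissible_const 0).integrable_ptLoss hr hg).sub (hf.1.integrable_ptLoss hr hg), ?_⟩
    -- By convexity the critical value f(x) minimizes the pointwise loss, so the change is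
    -- nonnegative; convexity on the segment to 0 bounds it above.
    intro x ε hε
    have hconv : ConvexOn ℝ Set.univ (ptLoss phi vphi pr pg x) :=
      (hc1.smul (hg.nonneg x)).add (hc2.smul (hr.nonneg x))
    have hder : HasDerivAt (ptLoss phi vphi pr pg x) 0 (f x) := by
      have h := hasDerivAt_ptLoss (pr := pr) (pg := pg) hdphi hdvphi x (f x)
      rwa [← ptGrad_eq hdphi hdvphi, hgrad x] at h
    have hmin : IsMinOn (ptLoss phi vphi pr pg x) Set.univ (f x) :=
      hconv.isMinOn_of_rightDeriv_eq_zero (by simp)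
        (hder.hasDerivWithinAt.derivWithin (uniqueDiffWithinAt_Ioi _))
    have h1 : ptLoss phi vphi pr pg x (f x) ≤ ptLoss phi vphi pr pg x ((1 - ε) * f x) :=
      hmin (Set.mem_univ _)
    have h2 := hconv.2 (Set.mem_univ (f x)) (Set.mem_univ 0) (sub_nonneg.2 hε.2) hε.1.le (by ring)
    simp only [smul_eq_mul, mul_zero, add_zero] at h2
    rw [abs_of_nonneg (sub_nonneg.2 h1)]
    linarith
  -- On compact supports `f` is bounded, and the mean value inequality applies to `phi` and `vphi`.
  · have hScomp : IsCompact (Pr.support ∪ Pg.support) := Metric.isCompact_of_isClosed_isBounded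
      (Measure.isClosed_support.union Measure.isClosed_support) hbdd
    obtain ⟨M, hM⟩ := hScomp.exists_bound_of_continuousOn hf.1.continuous.continuousOn
    obtain ⟨N₁, hN₁⟩ := (isCompact_Icc (a := -M) (b := M)).exists_bound_of_continuousOn
      (hphi.continuous_deriv le_rfl).continuousOn
    obtain ⟨N₂, hN₂⟩ := (isCompact_Icc (a := -M) (b := M)).exists_bound_of_continuousOn
      (hvphi.continuous_deriv le_rfl).continuousOn
    have hipr : Integrable pr := by simpa using (hr.integrable_iff _).1 (integrable_const (1 : ℝ))
    have hipg : Integrable pg := by simpa using (hg.integrable_iff _).1 (integrable_const (1 : ℝ))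
    refine ⟨fun x => pg x * (N₁ * M) + pr x * (N₂ * M),
      (hipg.mul_const _).add (hipr.mul_const _), fun x ε hε => ?_⟩
    by_cases hx : x ∈ Pr.support ∪ Pg.support
    · have hfx : |f x| ≤ M := hM x hx
      have hmem : f x ∈ Set.Icc (-M) M := abs_le.1 hfx
      have hmem' : (1 - ε) * f x ∈ Set.Icc (-M) M := by
        refine abs_le.1 ?_
        rw [abs_mul, abs_of_nonneg (sub_nonneg.2 hε.2)]
        calc (1 - ε) * |f x| ≤ 1 * M := by
              gcongr
              linarith [hε.1]
          _ = M := one_mul M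
      have hmv : ∀ (u : ℝ → ℝ) (N : ℝ), Differentiable ℝ u →
          (∀ s ∈ Set.Icc (-M) M, ‖deriv u s‖ ≤ N) →
          |u ((1 - ε) * f x) - u (f x)| ≤ ε * (N * M) := by
        intro u N hu hN
        have h := (convex_Icc (-M) M).norm_image_sub_le_of_norm_deriv_le (fun s _ => hu s) hN
          hmem hmem'
        have hN0 : 0 ≤ N := (norm_nonneg _).trans (hN _ hmem)
        rw [show (1 - ε) * f x - f x = -(ε * f x) by ring, norm_neg, norm_mul,
          Real.norm_of_nonneg hε.1.le] at h
        refine h.trans ?_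
        calc N * (ε * ‖f x‖) ≤ N * (ε * M) := by
              have := hε.1.le
              gcongr
              exact hfx
          _ = ε * (N * M) := by ring
      have h1 := hmv phi N₁ hdphi hN₁
      have h2 := hmv vphi N₂ hdvphi hN₂
      have h3 : ptLoss phi vphi pr pg x ((1 - ε) * f x) - ptLoss phi vphi pr pg x (f x) =
          pg x * (phi ((1 - ε) * f x) - phi (f x)) +
            pr x * (vphi ((1 - ε) * f x) - vphi (f x)) := by
        unfold ptLoss
        ring
      rw [h3]
      refine (abs_add_le _ _).trans ?_
      rw [abs_mul, abs_mul, abs_of_nonneg (hg.nonneg x), abs_of_nonneg (hr.nonneg x)]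
      have h4 := mul_le_mul_of_nonneg_left h1 (hg.nonneg x)
      have h5 := mul_le_mul_of_nonneg_left h2 (hr.nonneg x)
      linarith
    · simp [ptLoss, hr.eq_zero_of_notMem_support fun h => hx (Or.inl h),
        hg.eq_zero_of_notMem_support fun h => hx (Or.inr h)]

/-- Along (1 - ε)f the loss has zero derivative at ε = 0 by dominated convergence, so optimality
leaves no room for a first-order drop of the penalty. -/
theorem IsOptimalDisc.lipConst_eq_zero_of_ptGrad_eq_zero [IsProbabilityMeasure Pr]
    [IsProbabilityMeasure Pg] (hphi : ContDiff ℝ 1 phi) (hvphi : ContDiff ℝ 1 vphi)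
    (hmono : Monotone phi) (hanti : Antitone vphi) (hlam : 0 < lam)
    (hr : HasContDensity Pr pr) (hg : HasContDensity Pg pg)
    (hf : IsOptimalDisc phi vphi lam Pr Pg f)
    (hcase : (ConvexOn ℝ Set.univ phi ∧ ConvexOn ℝ Set.univ vphi) ∨
      Bornology.IsBounded (Pr.support ∪ Pg.support))
    (hgrad : ∀ x, ptGrad phi vphi pr pg f x = 0) : lipConst f = 0 := by
  have hdphi : Differentiable ℝ phi := hphi.differentiable one_ne_zero
  have hdvphi : Differentiable ℝ vphi := hvphi.differentiable one_ne_zero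
  have hlip := lipschitzWith_lipConst hf.1.1
  have hfc := hf.1.continuous
  have hcr := hr.continuous
  have hcg := hg.continuous
  have hcphi := hphi.continuous
  have hcvphi := hvphi.continuous
  obtain ⟨G, hG, hbound⟩ := hf.exists_integrable_bound_of_ptGrad_eq_zero hphi hvphi hr hg hcase
    hgrad
  set q : ℝ → Pt n → ℝ := fun ε x => ε⁻¹ *
    (ptLoss phi vphi pr pg x ((1 - ε) * f x) - ptLoss phi vphi pr pg x (f x)) with hq
  have hIoc : ∀ᶠ ε in 𝓝[>] (0 : ℝ), ε ∈ Set.Ioc (0 : ℝ) 1 := Ioc_mem_nhdsGT one_pos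
  have hlim : Tendsto (fun ε => ∫ x, q ε x) (𝓝[>] 0) (𝓝 (∫ _ : Pt n, (0 : ℝ))) := by
    refine tendsto_integral_filter_of_dominated_convergence G
      (Eventually.of_forall fun ε => ?_) ?_ hG (ae_of_all _ fun x => ?_)
    · refine Continuous.aestronglyMeasurable ?_
      simp only [hq, ptLoss]
      fun_prop
    · filter_upwards [hIoc] with ε hε
      refine ae_of_all _ fun x => ?_
      have := hbound x ε hε
      have h0 := hε.1
      rw [hq, norm_mul, norm_inv, Real.norm_of_nonneg h0.le, Real.norm_eq_abs, inv_mul_le_iff₀ h0]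
      exact this
    · have hin : HasDerivAt (fun ε : ℝ => (1 - ε) * f x) (-f x) 0 := by
        simpa using ((hasDerivAt_id (0 : ℝ)).const_sub 1).mul_const (f x)
      have hout : HasDerivAt (ptLoss phi vphi pr pg x) 0 ((1 - 0) * f x) := by
        have h := hasDerivAt_ptLoss (pr := pr) (pg := pg) hdphi hdvphi x (f x)
        rw [← ptGrad_eq hdphi hdvphi, hgrad x] at h
        simpa using h
      have hcomp := (hout.comp (0 : ℝ) hin).tendsto_slope_zero_right
      simpa [hq] using hcomp
  -- The penalty drops by at least lam k² (2ε - ε²) ≥ lam k² ε, which the increase of the loss must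
  -- compensate.
  have hlow : ∀ᶠ ε in 𝓝[>] (0 : ℝ), lam * (lipConst f : ℝ) ^ 2 ≤ ∫ x, q ε x := by
    filter_upwards [hIoc] with ε hε
    have hε1 : 0 ≤ 1 - ε := sub_nonneg.2 hε.2
    have hlip' : LipschitzWith ((1 - ε).toNNReal * lipConst f) fun x => (1 - ε) * f x := by
      refine LipschitzWith.of_dist_le_mul fun x y => ?_
      have := hlip.dist_le_mul x y
      rw [Real.dist_eq] at this ⊢
      rw [← mul_sub, abs_mul, abs_of_nonneg hε1, NNReal.coe_mul, Real.coe_toNNReal _ hε1, mul_assoc]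
      gcongr
    have hmem : ∀ x, (1 - ε) * f x ∈ Set.uIcc (f x) 0 := by
      intro x
      have h0 := hε.1
      rw [Set.mem_uIcc]
      rcases le_total 0 (f x) with h | h
      · exact Or.inr ⟨mul_nonneg hε1 h, by nlinarith⟩
      · exact Or.inl ⟨by nlinarith, mul_nonpos_of_nonneg_of_nonpos hε1 h⟩
    have hadm : Admissible phi vphi Pr Pg fun x => (1 - ε) * f x :=
      ⟨⟨_, hlip'⟩,
        integrable_comp_of_mem_uIcc hcphi (Or.inl hmono) (by fun_prop) hf.1.2.1 0 hmem,
        integrable_comp_of_mem_uIcc hcvphi (Or.inr hanti) (by fun_prop) hf.1.2.2 0 hmem⟩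
    have hmin := hf.2 _ hadm
    have hk : (lipConst fun x => (1 - ε) * f x : ℝ) ≤ (1 - ε) * lipConst f := by
      simpa [Real.coe_toNNReal _ hε1] using NNReal.coe_le_coe.2 (lipConst_le hlip')
    have hk2 : (lipConst fun x => (1 - ε) * f x : ℝ) ^ 2 ≤ (1 - ε) ^ 2 * (lipConst f : ℝ) ^ 2 := by
      rw [← mul_pow]
      gcongr
    have hk3 := mul_le_mul_of_nonneg_left hk2 hlam.le
    simp only [penObj] at hmin
    rw [hf.1.discLoss_eq hr hg, hadm.discLoss_eq hr hg] at hmin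
    rw [hq, integral_const_mul,
      integral_sub (hadm.integrable_ptLoss hr hg) (hf.1.integrable_ptLoss hr hg),
      le_inv_mul_iff₀ hε.1]
    -- The slack in 2ε - ε² = ε + ε(1 - ε).
    have hsq : 0 ≤ lam * (lipConst f : ℝ) ^ 2 * (ε * (1 - ε)) := by
      have := hε.1.le
      positivity
    nlinarith
  have hle := ge_of_tendsto hlim hlow
  rw [integral_zero] at hle
  have hsq : (lipConst f : ℝ) ^ 2 ≤ 0 := by
    by_contra! h
    linarith [mul_pos hlam h]
  exact_mod_cast pow_eq_zero_iff two_ne_zero |>.1 (le_antisymm hsq (sq_nonneg _))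

end ConstantDiscriminator

/-! ### Nash equilibria and first-order equilibria. -/

section Equilibrium

variable {n : ℕ} {phi vphi : ℝ → ℝ} {lam : ℝ} {Pr Pg : Measure (Pt n)} {f : Pt n → ℝ}

/-- A bounded point at which the derivative vanishes forces the function to be constant. -/
theorem lipConst_eq_zero_of_bounds_of_hasFDerivAt (hf : ∃ K : ℝ≥0, LipschitzWith K f)
    {x y : Pt n} (hb : Bounds f x y) (hd : HasFDerivAt f (0 : Pt n →L[ℝ] ℝ) x) :
    lipConst f = 0 := by
  have hlip := lipschitzWith_lipConst hf
  have hxy : 0 < dist x y := dist_pos.2 hb.1.symm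
  have heq : |f y - f x| = lipConst f * dist x y := by
    rw [hb.2, ← dist_eq_norm, dist_comm]
  have hline : HasDerivAt (fun s : ℝ => f (AffineMap.lineMap x y s)) 0 0 := by
    have h0 : HasFDerivAt f (0 : Pt n →L[ℝ] ℝ) (AffineMap.lineMap x y (0 : ℝ)) := by simpa using hd
    have hl : HasDerivAt (fun s : ℝ => (AffineMap.lineMap x y s : Pt n)) (y - x) 0 :=
      AffineMap.hasDerivAt_lineMap
    exact h0.comp_hasDerivAt (0 : ℝ) hl
  have hlim := hline.tendsto_slope_zero_right.abs
  -- From parameter s to y, `f` varies by at most (1 - s) k dist x y; the total variation is k dist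
  -- x y, so at least the share s is attained before s.
  have hlow : ∀ᶠ s in 𝓝[>] (0 : ℝ), (lipConst f : ℝ) * dist x y ≤
      |s⁻¹ • (f (AffineMap.lineMap x y (0 + s)) - f (AffineMap.lineMap x y (0 : ℝ)))| := by
    filter_upwards [Ioc_mem_nhdsGT (one_pos : (0 : ℝ) < 1)] with s hs
    have h1 := hlip.dist_le_mul y (AffineMap.lineMap x y s)
    rw [dist_comm y, dist_lineMap_right, Real.norm_of_nonneg (sub_nonneg.2 hs.2),
      Real.dist_eq] at h1
    have h2 := abs_sub_le (f y) (f (AffineMap.lineMap x y s)) (f x)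
    rw [zero_add, AffineMap.lineMap_apply_zero, smul_eq_mul, abs_mul, abs_inv, abs_of_pos hs.1,
      le_inv_mul_iff₀ hs.1]
    linarith
  have hle := ge_of_tendsto hlim hlow
  rw [abs_zero] at hle
  have h0 : (lipConst f : ℝ) ≤ 0 := by
    by_contra! h
    linarith [mul_pos h hxy]
  exact_mod_cast le_antisymm h0 (lipConst f).coe_nonneg

theorem IsNash.lipConst_eq_zero [IsProbabilityMeasure Pr] (hmono : StrictMono phi)
    (hanti : Antitone vphi) (hlam : 0 < lam) (h : IsNash phi vphi lam Pr Pg f) :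
    lipConst f = 0 := by
  obtain ⟨hPg, hopt, hmax⟩ := h
  -- The generator may move all its mass to a single point x.
  have hdirac : ∀ x, phi (f x) ≤ ∫ y, phi (f y) ∂Pg := by
    intro x
    have := hmax (Measure.dirac x) inferInstance (integrable_dirac (by simp))
    simp only [penObj, discLoss, integral_dirac] at this
    linarith
  -- A function bounded above by its own mean equals it almost everywhere; any such point maximizes
  -- `f`.
  have hae : ∀ᵐ x ∂Pg, phi (f x) = ∫ y, phi (f y) ∂Pg := by
    have hint : Integrable (fun x => (∫ y, phi (f y) ∂Pg) - phi (f x)) Pg :=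
      (integrable_const _).sub hopt.1.2.1
    have h0 : ∫ x, ((∫ y, phi (f y) ∂Pg) - phi (f x)) ∂Pg = 0 := by
      rw [integral_sub (integrable_const _) hopt.1.2.1]
      simp
    have := (integral_eq_zero_iff_of_nonneg (fun x => sub_nonneg.2 (hdirac x)) hint).1 h0
    filter_upwards [this] with x hx
    exact (sub_eq_zero.1 hx).symm
  obtain ⟨x₀, hx₀⟩ := hae.exists
  have hle : ∀ x, f x ≤ f x₀ := fun x => hmono.le_iff_le.1 (hx₀ ▸ hdirac x)
  have hmin := hopt.2 _ (admissible_const (f x₀))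
  rw [penObj_const] at hmin
  have hvint : vphi (f x₀) ≤ ∫ x, vphi (f x) ∂Pr := by
    have := integral_mono (integrable_const (vphi (f x₀))) hopt.1.2.2 fun x => hanti (hle x)
    simpa using this
  simp only [penObj, discLoss] at hmin
  rw [← hx₀] at hmin
  have hsq : (lipConst f : ℝ) ^ 2 ≤ 0 := by
    by_contra! h
    linarith [mul_pos hlam h]
  exact_mod_cast pow_eq_zero_iff two_ne_zero |>.1 (le_antisymm hsq (sq_nonneg _))

/-- With equal distributions the loss is the expectation of (phi + vphi)(g), minimized pointwise by
a. Against a constant every generator has the same payoff. -/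
theorem isNash_const [IsProbabilityMeasure Pr] {a : ℝ} (hmin : ∀ t, phi a + vphi a ≤ phi t + vphi t)
    (hlam : 0 < lam) : IsNash phi vphi lam Pr Pr fun _ => a := by
  refine ⟨inferInstance, ⟨admissible_const a, fun g hg => ?_⟩, fun Q _ _ => ?_⟩
  · rw [penObj_const, penObj, discLoss, ← integral_add hg.2.1 hg.2.2]
    have h1 := integral_mono (integrable_const (phi a + vphi a)) (hg.2.1.add hg.2.2)
      fun x => hmin (g x)
    simp only [integral_const, probReal_univ, one_smul, Pi.add_apply] at h1
    have : 0 ≤ lam * (lipConst g : ℝ) ^ 2 := by positivity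
    linarith
  · rw [penObj_const, penObj_const]

end Equilibrium

/-! ### Bounding relations and equilibria combined. -/

theorem theorem2 {n : ℕ} (phi vphi : ℝ → ℝ)
    (hphi : ContDiff ℝ 1 phi) (hvphi : ContDiff ℝ 1 vphi)
    (hphi' : ∀ t, 0 < deriv phi t) (hvphi' : ∀ t, deriv vphi t < 0)
    (lam : ℝ) (hlam : 0 < lam)
    (Pr : Measure (Pt n)) [IsProbabilityMeasure Pr] :
    (∀ (Pg : Measure (Pt n)) [IsProbabilityMeasure Pg] (pr pg : Pt n → ℝ) (f : Pt n → ℝ),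
      HasContDensity Pr pr → HasContDensity Pg pg → IsOptimalDisc phi vphi lam Pr Pg f →
        -- (a)
        (∀ x ∈ Pr.support ∪ Pg.support, ptGrad phi vphi pr pg f x ≠ 0 →
          ∃ y ∈ Function.support pr ∪ Function.support pg, Bounds f x y) ∧
        -- (b), at the points where exactly one of the densities is nonzero
        (∀ x ∈ (Function.support pr ∪ Function.support pg) \
            (Function.support pr ∩ Function.support pg),
          ∃ y ∈ Function.support pr ∪ Function.support pg, Bounds f x y) ∧
        -- (b), for the closed supports, when they are bounded
        (Bornology.IsBounded (Pr.support ∪ Pg.support) →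
          ∀ x ∈ (Pr.support ∪ Pg.support) \ (Pr.support ∩ Pg.support),
            ∃ y ∈ Pr.support ∪ Pg.support, Bounds f x y) ∧
        -- (c), and uniqueness of first-order equilibria in (d)
        ((ConvexOn ℝ Set.univ phi ∧ ConvexOn ℝ Set.univ vphi) ∨
            Bornology.IsBounded (Pr.support ∪ Pg.support) →
          (Pr.support = Pg.support → Pr ≠ Pg →
            ∃ x ∈ Function.support pr ∪ Function.support pg,
              ∃ y ∈ Function.support pr ∪ Function.support pg,
                Bounds f x y ∧ ptGrad phi vphi pr pg f x ≠ 0) ∧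
          (IsFirstOrderEquilibrium phi vphi lam Pr Pg pr pg f → Pg = Pr ∧ lipConst f = 0))) ∧
    -- (d) every Nash equilibrium
    (∀ (Pg : Measure (Pt n)) (f : Pt n → ℝ),
      IsNash phi vphi lam Pr Pg f → Pg = Pr ∧ lipConst f = 0) ∧
    -- (d) existence, and uniqueness of the pair
    (ConvexOn ℝ Set.univ phi → ConvexOn ℝ Set.univ vphi →
      (∃ a, deriv phi a + deriv vphi a = 0) →
        (∃ f : Pt n → ℝ, IsNash phi vphi lam Pr Pr f) ∧
        (StrictConvexOn ℝ Set.univ phi ∨ StrictConvexOn ℝ Set.univ vphi →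
          ∃! e : Measure (Pt n) × (Pt n → ℝ), IsNash phi vphi lam Pr e.1 e.2)) := by
  have hdphi : Differentiable ℝ phi := hphi.differentiable one_ne_zero
  have hdvphi : Differentiable ℝ vphi := hvphi.differentiable one_ne_zero
  have hmono : StrictMono phi := strictMono_of_deriv_pos hphi'
  have hanti : StrictAnti vphi := strictAnti_of_deriv_neg hvphi'
  have hnash : ∀ (Pg : Measure (Pt n)) (f : Pt n → ℝ),
      IsNash phi vphi lam Pr Pg f → Pg = Pr ∧ lipConst f = 0 := by
    intro Pg f h
    have hPg := h.1
    have h0 := h.lipConst_eq_zero hmono hanti.antitone hlam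
    exact ⟨h.2.1.measure_eq_of_lipConst_eq_zero hphi hvphi hphi' hlam h0, h0⟩
  refine ⟨?_, hnash, ?_⟩
  · intro Pg _ pr pg f hr hg hf
    refine ⟨?_, ?_, ?_, fun hcase => ⟨?_, ?_⟩⟩
    · intro x _ hx
      exact hf.exists_bounds_of_ptGrad_ne_zero hphi hvphi hlam hr hg hx
    · rintro x ⟨hx, hx'⟩
      refine hf.exists_bounds_of_ptGrad_ne_zero hphi hvphi hlam hr hg ?_
      rw [ptGrad_eq hdphi hdvphi]
      rcases hx with hx | hx
      · have hpg : pg x = 0 := by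
          by_contra h
          exact hx' ⟨hx, h⟩
        rw [hpg, zero_mul, zero_add]
        exact mul_ne_zero hx (hvphi' _).ne
      · have hpr : pr x = 0 := by
          by_contra h
          exact hx' ⟨h, hx⟩
        rw [hpr, zero_mul, add_zero]
        exact mul_ne_zero hx (hphi' _).ne'
    · rintro hbdd x ⟨hx, hx'⟩
      by_cases hxr : x ∈ Pr.support
      · have hxg : x ∉ Pg.support := fun h => hx' ⟨hxr, h⟩
        obtain ⟨y, hy, hb⟩ := hf.neg.exists_bounds_of_mem_support_gen
          (hvphi.continuous.comp continuous_neg) (hphi.continuous.comp continuous_neg)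
          (fun s t hst => hanti (neg_lt_neg hst)) hlam hg hr (by rwa [Set.union_comm]) hxr hxg
        exact ⟨y, Or.symm hy, bounds_neg_iff.1 hb⟩
      · exact hf.exists_bounds_of_mem_support_gen hphi.continuous hvphi.continuous hmono hlam hr hg
          hbdd (hx.resolve_left hxr) hxr
    · intro _ hne
      by_contra! hno
      -- Any point with nonzero derivative lies where a density is nonzero and is bounded, so it
      -- would yield the excluded pair.
      have hzero : ∀ x, ptGrad phi vphi pr pg f x = 0 := by
        intro x
        by_contra hx
        obtain ⟨y, hy, hb⟩ := hf.exists_bounds_of_ptGrad_ne_zero hphi hvphi hlam hr hg hx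
        exact hx (hno x (mem_support_of_ptGrad_ne_zero hdphi hdvphi hx) y hy hb)
      have h0 := hf.lipConst_eq_zero_of_ptGrad_eq_zero hphi hvphi hmono.monotone hanti.antitone hlam
        hr hg hcase hzero
      exact hne (hf.measure_eq_of_lipConst_eq_zero hphi hvphi hphi' hlam h0).symm
    · rintro ⟨-, hdiff, hcrit⟩
      suffices h0 : lipConst f = 0 from
        ⟨hf.measure_eq_of_lipConst_eq_zero hphi hvphi hphi' hlam h0, h0⟩
      by_cases hzero : ∀ x, ptGrad phi vphi pr pg f x = 0
      · exact hf.lipConst_eq_zero_of_ptGrad_eq_zero hphi hvphi hmono.monotone hanti.antitone hlam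
          hr hg hcase hzero
      push Not at hzero
      obtain ⟨x, hx⟩ := hzero
      obtain ⟨y, -, hb⟩ := hf.exists_bounds_of_ptGrad_ne_zero hphi hvphi hlam hr hg hx
      have hxS : x ∈ Pr.support ∪ Pg.support := by
        rw [hr.support_eq, hg.support_eq]
        exact (mem_support_of_ptGrad_ne_zero hdphi hdvphi hx).imp (fun h => subset_closure h)
          fun h => subset_closure h
      have hgr : gradient f x = 0 := (smul_eq_zero.1 (hcrit x hxS)).resolve_left hx
      have hfd := (hdiff x).hasGradientAt.hasFDerivAt
      rw [hgr, map_zero] at hfd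
      exact lipConst_eq_zero_of_bounds_of_hasFDerivAt hf.1.1 hb hfd
  · rintro hc1 hc2 ⟨a, ha⟩
    have hmin : ∀ t, phi a + vphi a ≤ phi t + vphi t := by
      have hder : HasDerivAt (phi + vphi) 0 a := ha ▸ (hdphi a).hasDerivAt.add (hdvphi a).hasDerivAt
      have h := (hc1.add hc2).isMinOn_of_rightDeriv_eq_zero (x := a) (by simp)
        (hder.hasDerivWithinAt.derivWithin (uniqueDiffWithinAt_Ioi _))
      exact fun t => h (Set.mem_univ t)
    refine ⟨⟨_, isNash_const hmin hlam⟩, fun hstrict => ⟨(Pr, fun _ => a), isNash_const hmin hlam, ?_⟩⟩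
    -- Any equilibrium discriminator is constant, and its value minimizes phi + vphi; strict
    -- convexity of the sum leaves only a.
    have hsc : StrictConvexOn ℝ Set.univ (phi + vphi) := by
      rcases hstrict with h | h
      · exact h.add_convexOn hc2
      · exact hc1.add_strictConvexOn h
    rintro ⟨Pg, f⟩ hN
    obtain ⟨rfl, h0⟩ := hnash Pg f hN
    have hconst : f = fun _ => f 0 := funext fun x => eq_of_lipConst_eq_zero hN.2.1.1.1 h0 x 0
    have hle := hN.2.1.2 _ (admissible_const a)
    rw [hconst] at hle
    simp only [penObj_const] at hle
    have heq : f 0 = a := hsc.eq_of_isMinOn (fun t _ => hle.trans (hmin t)) (fun t _ => hmin t)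
      (Set.mem_univ _) (Set.mem_univ _)
    rw [hconst, heq]
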